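/- Let $R$ be a commutative noetherian local ring with maximal ideal $\mathfrak m$ and residue field $k=R/\mathfrak m$. Let $\widehat R$ be the $\mathfrak m$-adic completion of $R$, let $E=E_R(k)$ be the injective hull of $k$, and write $M^\vee=\operatorname{Hom}_R(M,E)$ for an $R$-module $M$. For an $R$-module $L$ set $\Gamma_{\mathfrak m}(L)=\{x\in L\mid \mathfrak m^n x=0 \text{ for } n\gg 0\}$ and $\mu^0_R(L)=\operatorname{len}_R(\operatorname{Ext}^0_R(k,L))$. An $R$-module $M$ with $M=\Gamma_{\mathfrak m}(M)$ (for example $\Gamma_{\mathfrak m}(L)$, or any artinian $R$-module) is an $\widehat R$-module: if $\mathfrak m^n x=0$ and $r_0\in R$ has the same class as $r\in\widehat R$ in $R/\mathfrak m^n\cong\widehat R/\mathfrak m^n\widehat R$, then $rx=r_0x$. Its dual $M^\vee$ is then an $\widehat R$-module by $(rf)(x)=f(rx)$. An element $x$ is called a non-zero-divisor for a module $M$ if multiplication by $x$ on $M$ is injective. For an artinian $\widehat R$-module $A$, $\operatorname{Att}_{\widehat R}(A)$ is the set of prime ideals of $\widehat R$ of the form $\operatorname{Ann}_{\widehat R}(A/A')$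 with $A'\subseteq A$ a submodule, and $\operatorname{Supp}_{\widehat R}(M)=\{\mathfrak p\in\operatorname{Spec}\widehat R\mid M_{\mathfrak p}\neq 0\}$. **Theorem.** Let $A$ and $L$ be $R$-modules such that $A$ is artinian and $\mu^0_R(L)<\infty$. The following conditions are equivalent: 1. $\operatorname{Hom}_R(A,L)=0$; 2. $\operatorname{Hom}_R(A,\Gamma_{\mathfrak m}(L))=0$; 3. $\operatorname{Hom}_{\widehat R}(\Gamma_{\mathfrak m}(L)^\vee,A^\vee)=0$; 4. there is an element $x\in\operatorname{Ann}_{\widehat R}(\Gamma_{\mathfrak m}(L))$ such that $A=xA$; 5. $\operatorname{Ann}_{\widehat R}(\Gamma_{\mathfrak m}(L))\,A=A$; 6. $\operatorname{Ann}_{\widehat R}(\Gamma_{\mathfrak m}(L))$ contains a non-zero-divisor for $A^\vee$; 7. $\operatorname{Att}_{\widehat R}(A)\cap\operatorname{Supp}_{\widehat R}(\Gamma_{\mathfrak m}(L)^\vee)=\emptyset$. -/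

import Mathlib

open IsLocalRing

universe u v

/-! ### Injective hulls -/

section InjectiveHull

variable {R : Type u} [CommRing R]

/-- An injective homomorphism `ι : M → E` exhibits `E` as an injective hull of `M` if `E` is an
injective module and every nonzero submodule of `E` meets the image of `M` nontrivially. -/
structure IsInjectiveHull {M E : Type u} [AddCommGroup M] [Module R M] [AddCommGroup E]
    [Module R E] (ι : M →ₗ[R] E) : Prop where
  injective : Function.Injective ι
  essential : ∀ N : Submodule R E, N ⊓ LinearMap.range ι = ⊥ → N = ⊥
  module_injective : Module.Injective R E

variable (R) in
/-- Every module has an injective hull. -/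
theorem exists_isInjectiveHull (M : Type u) [AddCommGroup M] [Module R M] :
    ∃ (E : ModuleCat.{u} R) (ι : M →ₗ[R] E), IsInjectiveHull ι := by
  let J : ModuleCat.{u} R := CategoryTheory.Injective.under (ModuleCat.of R M)
  let i : M →ₗ[R] J := (CategoryTheory.Injective.ι (ModuleCat.of R M)).hom
  have hi : Function.Injective i :=
    (ModuleCat.mono_iff_injective _).1
      (inferInstance : CategoryTheory.Mono (CategoryTheory.Injective.ι (ModuleCat.of R M)))
  have hJ : Module.Injective R J :=
    Module.injective_module_of_injective_object R J
      (inj := (inferInstance :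
        CategoryTheory.Injective (CategoryTheory.Injective.under (ModuleCat.of R M))))
  let K : Submodule R J := LinearMap.range i
  let S : Set (Submodule R J) :=
    {N | K ≤ N ∧ ∀ x ∈ N, x ≠ 0 → ∃ r : R, r • x ≠ 0 ∧ r • x ∈ K}
  have hKS : K ∈ S := ⟨le_rfl, fun x hx h0 => ⟨1, by simpa using h0, by simpa using hx⟩⟩
  obtain ⟨N, -, hN⟩ := zorn_le_nonempty₀ S (fun c hc hchain y hy => by
    refine ⟨sSup c, ⟨(hc hy).1.trans (le_sSup hy), fun x hx h0 => ?_⟩, fun z hz => le_sSup hz⟩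
    obtain ⟨z, hz, hxz⟩ :=
      (Submodule.mem_sSup_of_directed ⟨y, hy⟩ hchain.directedOn).1 hx
    exact (hc hz).2 x hxz h0) K hKS
  have hNS : N ∈ S := hN.prop
  obtain ⟨C, -, hC⟩ := zorn_le_nonempty₀ {C : Submodule R J | ∀ x ∈ C, x ∈ N → x = 0}
    (fun c hc hchain y hy => by
      refine ⟨sSup c, fun x hx hxN => ?_, fun z hz => le_sSup hz⟩
      obtain ⟨z, hz, hxz⟩ :=
        (Submodule.mem_sSup_of_directed ⟨y, hy⟩ hchain.directedOn).1 hx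
      exact hc hz x hxz hxN) ⊥ (fun x hx _ => by simpa using hx)
  have hCN : ∀ x ∈ C, x ∈ N → x = 0 := hC.prop
  -- every element outside `C` has a multiple congruent to a nonzero element of `N`
  have key : ∀ j : J, j ∉ C → ∃ n ∈ N, n ≠ 0 ∧ ∃ r : R, r • j - n ∈ C := by
    intro j hj
    by_contra! hcon
    have hmem : C ⊔ Submodule.span R {j} ∈ {C : Submodule R J | ∀ x ∈ C, x ∈ N → x = 0} := by
      intro x hx hxN
      by_contra h0
      obtain ⟨c, hc, y, hy, rfl⟩ := Submodule.mem_sup.1 hx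
      obtain ⟨r, rfl⟩ := Submodule.mem_span_singleton.1 hy
      refine hcon _ hxN h0 r ?_
      have : r • j - (c + r • j) = -c := by abel
      rw [this]
      exact C.neg_mem hc
    have hle := hC.le_of_ge hmem le_sup_left
    exact hj (hle ((le_sup_right : Submodule.span R {j} ≤ _)
      (Submodule.mem_span_singleton_self j)))
  have hψ : Function.Injective (C.mkQ ∘ₗ N.subtype) := by
    rw [← LinearMap.ker_eq_bot, LinearMap.ker_eq_bot']
    intro x hx
    have hxC : (x : J) ∈ C := by simpa using hx
    exact Subtype.ext (hCN _ hxC x.2)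
  obtain ⟨φ, hφ⟩ := hJ.out (C.mkQ ∘ₗ N.subtype) hψ N.subtype
  have hφN : ∀ n ∈ N, φ (C.mkQ n) = n := fun n hn => hφ ⟨n, hn⟩
  have hφr : ∀ (j n : J) (r : R), n ∈ N → r • j - n ∈ C → r • φ (C.mkQ j) = n := by
    intro j n r hn h
    have h1 : C.mkQ (r • j) = C.mkQ n := (Submodule.Quotient.eq C).2 h
    rw [← map_smul, ← map_smul, h1, hφN n hn]
  have hle : N ≤ LinearMap.range φ := fun n hn => ⟨C.mkQ n, hφN n hn⟩
  have hrange : LinearMap.range φ ∈ S := by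
    refine ⟨hNS.1.trans hle, ?_⟩
    rintro _ ⟨y, rfl⟩ h0
    obtain ⟨j, rfl⟩ := C.mkQ_surjective y
    have hj : j ∉ C := by
      intro hj
      apply h0
      have : C.mkQ j = 0 := by simpa using hj
      rw [this, map_zero]
    obtain ⟨n, hn, hn0, r, hr⟩ := key j hj
    have h1 := hφr j n r hn hr
    obtain ⟨s, hs0, hsK⟩ := hNS.2 n hn hn0
    exact ⟨s * r, by rwa [mul_smul, h1], by rwa [mul_smul, h1]⟩
  have hrN : LinearMap.range φ ≤ N := hN.le_of_ge hrange hle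
  let ρ : J →ₗ[R] N := (φ ∘ₗ C.mkQ).codRestrict N (fun j => hrN ⟨_, rfl⟩)
  have hρ : ∀ n : N, ρ n = n := fun n => Subtype.ext (hφN n n.2)
  refine ⟨ModuleCat.of R N, i.codRestrict N (fun x => hNS.1 ⟨x, rfl⟩), ?_, ?_, ?_⟩
  · intro x y hxy
    exact hi (congrArg Subtype.val hxy)
  · intro P hP
    rw [eq_bot_iff]
    intro x hx
    by_contra h0
    have h0' : (x : N).1 ≠ 0 := fun h => h0 (by
      rw [Submodule.mem_bot]
      exact Subtype.ext h)
    obtain ⟨r, hr0, m, hm⟩ := hNS.2 (x : N).1 (x : N).2 h0'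
    have : r • x ∈ P ⊓ LinearMap.range (i.codRestrict N (fun x => hNS.1 ⟨x, rfl⟩)) :=
      ⟨P.smul_mem r hx, m, Subtype.ext hm⟩
    rw [hP, Submodule.mem_bot] at this
    exact hr0 (congrArg Subtype.val this)
  · refine ⟨fun X Y _ _ _ _ f hf g => ?_⟩
    obtain ⟨h, hh⟩ := hJ.out f hf (N.subtype ∘ₗ g)
    refine ⟨ρ ∘ₗ h, fun x => ?_⟩
    rw [LinearMap.comp_apply, hh]
    exact hρ (g x)

variable (R) in
/-- The injective hull `E_R(M)` of an `R`-module `M` (unique up to isomorphism). -/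
def InjectiveHull (M : Type u) [AddCommGroup M] [Module R M] : Type u :=
  (exists_isInjectiveHull R M).choose

namespace InjectiveHull

variable (M : Type u) [AddCommGroup M] [Module R M]

noncomputable instance : AddCommGroup (InjectiveHull R M) :=
  inferInstanceAs (AddCommGroup (exists_isInjectiveHull R M).choose)

noncomputable instance : Module R (InjectiveHull R M) :=
  inferInstanceAs (Module R (exists_isInjectiveHull R M).choose)

variable (R) in
/-- The embedding of a module in its injective hull. -/
noncomputable def ι : M →ₗ[R] InjectiveHull R M :=
  (exists_isInjectiveHull R M).choose_spec.choose

theorem isInjectiveHull_ι : IsInjectiveHull (ι R M) :=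
  (exists_isInjectiveHull R M).choose_spec.choose_spec

end InjectiveHull

end InjectiveHull

/-! ### Torsion modules and their structure over the completion -/

section Torsion

variable {R : Type u} [CommRing R] (I : Ideal R) (M : Type v) [AddCommGroup M] [Module R M]

/-- The `I`-torsion submodule `Γ_I(M) = {x ∈ M | I ^ n x = 0 for n ≫ 0}`. -/
def adicTorsion : Submodule R M where
  carrier := {x | ∃ n : ℕ, ∀ r ∈ I ^ n, r • x = 0}
  zero_mem' := ⟨0, fun r _ => smul_zero r⟩
  add_mem' := by
    rintro x y ⟨n, hn⟩ ⟨m, hm⟩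
    refine ⟨n + m, fun r hr => ?_⟩
    rw [smul_add, hn r (Ideal.pow_le_pow_right (Nat.le_add_right n m) hr),
      hm r (Ideal.pow_le_pow_right (Nat.le_add_left m n) hr), add_zero]
  smul_mem' := by
    rintro s x ⟨n, hn⟩
    exact ⟨n, fun r hr => by rw [smul_comm, hn r hr, smul_zero]⟩

/-- A module is `I`-torsion if `M = Γ_I(M)`. -/
class IsAdicTorsion : Prop where
  eq_top : adicTorsion I M = ⊤

instance isAdicTorsion_adicTorsion : IsAdicTorsion I (adicTorsion I M) where
  eq_top := by
    rw [eq_top_iff]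
    rintro ⟨x, n, hn⟩ -
    exact ⟨n, fun r hr => Subtype.ext (hn r hr)⟩

/-- Artinian modules over a noetherian local ring are torsion. -/
instance isAdicTorsion_of_isArtinian [IsNoetherianRing R] [IsLocalRing R] [IsArtinian R M] :
    IsAdicTorsion (maximalIdeal R) M where
  eq_top := by
    rw [eq_top_iff]
    intro x _
    let f : ℕ →o (Submodule R M)ᵒᵈ :=
      ⟨fun n => OrderDual.toDual ((maximalIdeal R) ^ n • Submodule.span R {x}), fun a b hab =>
        Submodule.smul_mono_left (Ideal.pow_le_pow_right hab)⟩
    obtain ⟨n, hn⟩ := IsArtinian.monotone_stabilizes f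
    have h1 : (maximalIdeal R) ^ n • Submodule.span R {x} =
        (maximalIdeal R) ^ (n + 1) • Submodule.span R {x} := hn (n + 1) (Nat.le_succ n)
    have h2 : (maximalIdeal R) ^ n • Submodule.span R {x} = ⊥ := by
      refine Submodule.eq_bot_of_le_smul_of_le_jacobson_bot (maximalIdeal R) _ ?_ ?_
        (IsLocalRing.maximalIdeal_le_jacobson _)
      · exact Submodule.FG.smul (IsNoetherian.noetherian _) (Submodule.fg_span_singleton x)
      · rw [← Submodule.mul_smul, ← pow_succ']
        exact h1.le
    refine ⟨n, fun r hr => ?_⟩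
    have : r • x ∈ (maximalIdeal R) ^ n • Submodule.span R {x} :=
      Submodule.smul_mem_smul hr (Submodule.mem_span_singleton_self x)
    rwa [h2, Submodule.mem_bot] at this

variable {M}

theorem exists_pow_smul_eq_zero [h : IsAdicTorsion I M] (x : M) :
    ∃ n : ℕ, ∀ r ∈ I ^ n, r • x = 0 := by
  have : x ∈ adicTorsion I M := by rw [h.eq_top]; trivial
  exact this

/-- The action of the completion on a torsion module: if `I ^ n x = 0` and `r₀ ∈ R` has the same
class modulo `I ^ n` as `r`, then `r x = r₀ x`. -/
noncomputable def completionSMul [IsAdicTorsion I M] (r : AdicCompletion I R) (x : M) : M :=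
  (Ideal.Quotient.mk_surjective
    (AdicCompletion.evalₐ I (exists_pow_smul_eq_zero I x).choose r)).choose • x

theorem completionSMul_eq [IsAdicTorsion I M] (r : AdicCompletion I R) (x : M) (n : ℕ)
    (hn : ∀ s ∈ I ^ n, s • x = 0) (r₀ : R)
    (hr : Ideal.Quotient.mk (I ^ n) r₀ = AdicCompletion.evalₐ I n r) :
    completionSMul I r x = r₀ • x := by
  have hm := (exists_pow_smul_eq_zero I x).choose_spec
  have hs := (Ideal.Quotient.mk_surjective
    (AdicCompletion.evalₐ I (exists_pow_smul_eq_zero I x).choose r)).choose_spec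
  unfold completionSMul
  generalize (Ideal.Quotient.mk_surjective
    (AdicCompletion.evalₐ I (exists_pow_smul_eq_zero I x).choose r)).choose = s at hs ⊢
  generalize (exists_pow_smul_eq_zero I x).choose = m at hm hs
  obtain ⟨c, rfl⟩ := AdicCompletion.mk_surjective I R r
  rw [AdicCompletion.evalₐ_mk, Ideal.Quotient.eq] at hr hs
  rw [← sub_eq_zero, ← sub_smul]
  have hc : ∀ {a b : ℕ}, a ≤ b → c.1 a - c.1 b ∈ I ^ a := by
    intro a b hab
    have := (SModEq.sub_mem.1 (c.2 hab))
    simpa using this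
  rcases le_total m n with h | h
  · apply hm
    have : s - r₀ = (s - c.1 m) + (c.1 m - c.1 n) - (r₀ - c.1 n) := by ring
    rw [this]
    exact Ideal.sub_mem _ (Ideal.add_mem _ hs (hc h)) (Ideal.pow_le_pow_right h hr)
  · apply hn
    have : s - r₀ = (s - c.1 m) - (c.1 n - c.1 m) - (r₀ - c.1 n) := by ring
    rw [this]
    exact Ideal.sub_mem _ (Ideal.sub_mem _ (Ideal.pow_le_pow_right h hs) (hc h)) hr

/-- An `I`-torsion `R`-module is a module over the `I`-adic completion of `R`. -/
noncomputable instance completionModule [IsAdicTorsion I M] : Module (AdicCompletion I R) M where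
  smul := completionSMul I
  one_smul x := by
    obtain ⟨n, hn⟩ := exists_pow_smul_eq_zero I x
    exact (completionSMul_eq I 1 x n hn 1 (by simp)).trans (one_smul R x)
  mul_smul r s x := by
    obtain ⟨n, hn⟩ := exists_pow_smul_eq_zero I x
    obtain ⟨r₀, hr⟩ := Ideal.Quotient.mk_surjective (AdicCompletion.evalₐ I n r)
    obtain ⟨s₀, hs⟩ := Ideal.Quotient.mk_surjective (AdicCompletion.evalₐ I n s)
    change completionSMul I (r * s) x = completionSMul I r (completionSMul I s x)
    rw [completionSMul_eq I s x n hn s₀ hs,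
      completionSMul_eq I r (s₀ • x) n (fun t ht => by rw [smul_comm, hn t ht, smul_zero]) r₀ hr,
      completionSMul_eq I (r * s) x n hn (r₀ * s₀) (by rw [map_mul, map_mul, hr, hs]), mul_smul]
  smul_zero r := by
    change completionSMul I r (0 : M) = 0
    exact smul_zero _
  smul_add r x y := by
    obtain ⟨n, hn⟩ := exists_pow_smul_eq_zero I x
    obtain ⟨m, hm⟩ := exists_pow_smul_eq_zero I y
    have hx : ∀ t ∈ I ^ (n + m), t • x = 0 := fun t ht =>
      hn t (Ideal.pow_le_pow_right (Nat.le_add_right n m) ht)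
    have hy : ∀ t ∈ I ^ (n + m), t • y = 0 := fun t ht =>
      hm t (Ideal.pow_le_pow_right (Nat.le_add_left m n) ht)
    obtain ⟨r₀, hr⟩ := Ideal.Quotient.mk_surjective (AdicCompletion.evalₐ I (n + m) r)
    change completionSMul I r (x + y) = completionSMul I r x + completionSMul I r y
    rw [completionSMul_eq I r x _ hx r₀ hr, completionSMul_eq I r y _ hy r₀ hr,
      completionSMul_eq I r (x + y) _
        (fun t ht => by rw [smul_add, hx t ht, hy t ht, add_zero]) r₀ hr, smul_add]
  add_smul r s x := by
    obtain ⟨n, hn⟩ := exists_pow_smul_eq_zero I x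
    obtain ⟨r₀, hr⟩ := Ideal.Quotient.mk_surjective (AdicCompletion.evalₐ I n r)
    obtain ⟨s₀, hs⟩ := Ideal.Quotient.mk_surjective (AdicCompletion.evalₐ I n s)
    change completionSMul I (r + s) x = completionSMul I r x + completionSMul I s x
    rw [completionSMul_eq I r x n hn r₀ hr, completionSMul_eq I s x n hn s₀ hs,
      completionSMul_eq I (r + s) x n hn (r₀ + s₀) (by rw [map_add, map_add, hr, hs]), add_smul]
  zero_smul x := by
    obtain ⟨n, hn⟩ := exists_pow_smul_eq_zero I x
    exact (completionSMul_eq I 0 x n hn 0 (by simp)).trans (zero_smul R x)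

theorem completion_smul_eq [IsAdicTorsion I M] (r : AdicCompletion I R) (x : M) (n : ℕ)
    (hn : ∀ s ∈ I ^ n, s • x = 0) (r₀ : R)
    (hr : Ideal.Quotient.mk (I ^ n) r₀ = AdicCompletion.evalₐ I n r) : r • x = r₀ • x :=
  completionSMul_eq I r x n hn r₀ hr

instance isScalarTower_completion [IsAdicTorsion I M] :
    IsScalarTower R (AdicCompletion I R) M where
  smul_assoc s r x := by
    obtain ⟨n, hn⟩ := exists_pow_smul_eq_zero I x
    obtain ⟨r₀, hr⟩ := Ideal.Quotient.mk_surjective (AdicCompletion.evalₐ I n r)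
    rw [completion_smul_eq I r x n hn r₀ hr, completion_smul_eq I (s • r) x n hn (s * r₀)
      (by rw [map_smul, map_mul, hr, Algebra.smul_def]; rfl), mul_smul]

instance smulCommClass_completion [IsAdicTorsion I M] :
    SMulCommClass R (AdicCompletion I R) M :=
  IsScalarTower.to_smulCommClass

end Torsion

/-! ### Matlis duality, Bass numbers, attached primes -/

section Local

variable (R : Type u) [CommRing R] [IsLocalRing R]

/-- The Matlis dual `M^∨ = Hom_R(M, E)`, where `E = E_R(k)` is the injective hull of the residue
field. -/
def MatlisDual (M : Type v) [AddCommGroup M] [Module R M] : Type (max u v) :=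
  M →ₗ[R] InjectiveHull R (ResidueField R)

namespace MatlisDual

variable {R} {M : Type v} [AddCommGroup M] [Module R M]

noncomputable instance : AddCommGroup (MatlisDual R M) :=
  inferInstanceAs (AddCommGroup (M →ₗ[R] InjectiveHull R (ResidueField R)))

noncomputable instance : FunLike (MatlisDual R M) M (InjectiveHull R (ResidueField R)) :=
  inferInstanceAs (FunLike (M →ₗ[R] InjectiveHull R (ResidueField R)) M _)

noncomputable instance : LinearMapClass (MatlisDual R M) R M (InjectiveHull R (ResidueField R)) :=
  inferInstanceAs (LinearMapClass (M →ₗ[R] InjectiveHull R (ResidueField R)) R M _)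

theorem ext {f g : MatlisDual R M} (h : ∀ x, f x = g x) : f = g :=
  DFunLike.ext f g h

theorem add_apply (f g : MatlisDual R M) (x : M) : (f + g) x = f x + g x :=
  rfl

theorem zero_apply (x : M) : (0 : MatlisDual R M) x = 0 :=
  rfl

/-- Scalars acting `R`-linearly on `M` act on `M^∨` by `(s f)(x) = f(s x)`. This is used for
scalars in `R`, where it is the usual structure, and for scalars in the completion of `R` when
`M` is torsion. -/
noncomputable instance {S : Type*} [CommRing S] [Module S M] [SMulCommClass R S M] :
    SMul S (MatlisDual R M) where
  smul s f :=
    { toFun := fun x => f (s • x)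
      map_add' := fun x y => by rw [smul_add, map_add]
      map_smul' := fun r x => by rw [← smul_comm r s x, map_smul]; rfl }

theorem smul_apply {S : Type*} [CommRing S] [Module S M] [SMulCommClass R S M] (s : S)
    (f : MatlisDual R M) (x : M) : (s • f) x = f (s • x) :=
  rfl

noncomputable instance {S : Type*} [CommRing S] [Module S M] [SMulCommClass R S M] :
    Module S (MatlisDual R M) where
  one_smul f := ext fun x => by rw [smul_apply, one_smul]
  mul_smul s t f := ext fun x => by simp only [smul_apply]; rw [mul_comm, mul_smul]
  smul_zero s := ext fun _ => rfl
  smul_add s f g := ext fun _ => rfl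
  add_smul s t f := ext fun x => by
    simp only [smul_apply, add_apply]; rw [add_smul, map_add]
  zero_smul f := ext fun x => by
    simp only [smul_apply, zero_apply]; rw [zero_smul, map_zero]

/-- For scalars in `R` the structure on `M^∨` is the usual one. -/
theorem smul_apply_self (r : R) (f : MatlisDual R M) (x : M) : (r • f) x = r • f x :=
  map_smul f r x

end MatlisDual

/-- The `i`-th Bass number `μ^i_R(M) = len_R(Ext^i_R(k, M))`. -/
noncomputable def bassNumber (i : ℕ) (M : Type u) [AddCommGroup M] [Module R M] : ℕ∞ :=
  Module.length R
    (CategoryTheory.Abelian.Ext (ModuleCat.of R (ResidueField R)) (ModuleCat.of R M) i)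

end Local

/-- The attached primes of an artinian `S`-module `A`: the primes of the form `Ann_S(A / A')` for
a submodule `A'` of `A`. -/
def attachedPrimes (S : Type u) [CommRing S] (A : Type v) [AddCommGroup A] [Module S A] :
    Set (PrimeSpectrum S) :=
  {p | ∃ A' : Submodule S A, p.asIdeal = Module.annihilator S (A ⧸ A')}

/-! Write Γ for the 𝔪-torsion of L and S for the completion. As A is torsion, every map A → L lands
in Γ, so only torsion modules and their S-duals matter. Functionals on a torsion module expand by
successive approximation with coefficients in S, once they do so on the socle
(`MatlisDual.exists_eq_sum_completion_smul`). Hence endomorphisms of E are scalars from S, A^∨ is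
noetherian, and Γ^∨ is finitely generated because the socle of Γ has finite length. Finite
generation gives biduality, so maps Γ^∨ → A^∨ are transposes of maps A → Γ
(`MatlisDual.exists_linearMap_of_dual`).

The rest is commutative algebra. Put 𝔞 = Ann Γ = Ann Γ^∨, so that Supp Γ^∨ = V(𝔞). If 𝔞 contains no
non-zero-divisor for A^∨, then 𝔞 ⊆ 𝔭 = Ann(f) for a prime 𝔭 and some f ∈ A^∨
(`exists_prime_eq_annihilator_of_not_isSMulRegular`). This 𝔭 defeats the other conditions: Γ^∨ maps
nontrivially to S/𝔭 ≅ Sf ⊆ A^∨, the nonzero f kills 𝔞A, and 𝔭 is attached to A. Conversely, x is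
regular on A^∨ iff xA = A; such an x in 𝔞 kills every map A → Γ and lies in no attached prime. -/

section CompletionLinear

variable {R : Type u} [CommRing R] {I : Ideal R}

/-- An `R`-linear map between torsion modules is linear over the completion. -/
theorem LinearMap.map_completion_smul {M N : Type*} [AddCommGroup M] [Module R M]
    [IsAdicTorsion I M] [AddCommGroup N] [Module R N] [IsAdicTorsion I N] (f : M →ₗ[R] N)
    (r : AdicCompletion I R) (x : M) : f (r • x) = r • f x := by
  obtain ⟨n, hn⟩ := exists_pow_smul_eq_zero I x
  obtain ⟨s, hs⟩ := Ideal.Quotient.mk_surjective (AdicCompletion.evalₐ I n r)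
  rw [completion_smul_eq I r x n hn s hs, map_smul,
    completion_smul_eq I r (f x) n (fun t ht => by rw [← map_smul, hn t ht, map_zero]) s hs]

end CompletionLinear

/-! ### Injective modules and the hull of the residue field -/

section InjectiveModule

variable {R : Type u} [CommRing R] {E : Type u} [AddCommGroup E] [Module R E]

/-- A map to an injective module factors through every map with smaller kernel. -/
theorem Module.Injective.exists_comp_eq (hE : Module.Injective R E) {M N : Type u}
    [AddCommGroup M] [Module R M] [AddCommGroup N] [Module R N] (F : M →ₗ[R] N) (f : M →ₗ[R] E)
    (h : LinearMap.ker F ≤ LinearMap.ker f) : ∃ g : N →ₗ[R] E, ∀ x, g (F x) = f x := by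
  obtain ⟨g, hg⟩ := hE.out ((LinearMap.ker F).liftQ F le_rfl)
    (LinearMap.ker_eq_bot.1 (Submodule.ker_liftQ_eq_bot _ _ _ le_rfl))
    ((LinearMap.ker F).liftQ f h)
  exact ⟨g, fun x => hg (Submodule.Quotient.mk x)⟩

end InjectiveModule

section Hull

variable (R : Type u) [CommRing R] [IsLocalRing R]

/-- The injective hull of the residue field is a cogenerator. -/
theorem exists_dual_apply_ne_zero {M : Type u} [AddCommGroup M] [Module R M] {x : M}
    (hx : x ≠ 0) : ∃ f : M →ₗ[R] InjectiveHull R (ResidueField R), f x ≠ 0 := by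
  have hι := InjectiveHull.isInjectiveHull_ι (R := R) (ResidueField R)
  -- Since x ≠ 0, its annihilator lies in 𝔪, so R → k → E factors through 1 ↦ x.
  obtain ⟨g, hg⟩ := hι.module_injective.exists_comp_eq (LinearMap.toSpanSingleton R M x)
    (InjectiveHull.ι R (ResidueField R) ∘ₗ Algebra.linearMap R (ResidueField R)) (by
      intro r hr
      rw [LinearMap.mem_ker, LinearMap.toSpanSingleton_apply] at hr
      rw [LinearMap.mem_ker, LinearMap.comp_apply, Algebra.linearMap_apply]
      have : residue R r = 0 := by
        rw [residue_eq_zero_iff, mem_maximalIdeal, mem_nonunits_iff]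
        exact fun h => hx (h.smul_eq_zero.1 hr)
      rw [ResidueField.algebraMap_eq, this, map_zero])
  refine ⟨g, fun h0 => ?_⟩
  have h1 := hg 1
  rw [LinearMap.toSpanSingleton_apply, one_smul, h0, LinearMap.comp_apply,
    Algebra.linearMap_apply, map_one] at h1
  exact one_ne_zero (hι.injective (h1.symm.trans (map_zero _).symm))

variable {R}

/-- The socle of the injective hull of the residue field is generated by one element. -/
theorem exists_eq_smul_ι_one {x : InjectiveHull R (ResidueField R)}
    (hx : ∀ r ∈ maximalIdeal R, r • x = 0) :
    ∃ c : R, x = c • InjectiveHull.ι R (ResidueField R) 1 := by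
  have hι := InjectiveHull.isInjectiveHull_ι (R := R) (ResidueField R)
  by_cases h0 : x = 0
  · exact ⟨0, by rw [h0, zero_smul]⟩
  have h1 : Submodule.span R {x} ⊓ LinearMap.range (InjectiveHull.ι R (ResidueField R)) ≠ ⊥ :=
    fun h => h0 (by simpa using hι.essential _ h)
  obtain ⟨y, ⟨hy, z, hz⟩, hy0⟩ := Submodule.exists_mem_ne_zero_of_ne_bot h1
  obtain ⟨r, rfl⟩ := Submodule.mem_span_singleton.1 hy
  -- A nonunit r would kill x.
  have hr : IsUnit r := by
    by_contra hr
    exact hy0 (hx r ((mem_maximalIdeal r).2 hr))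
  obtain ⟨u, rfl⟩ := hr
  obtain ⟨s, rfl⟩ := residue_surjective z
  refine ⟨(↑u⁻¹ : R) * s, ?_⟩
  rw [mul_smul, ← map_smul, Algebra.smul_def, mul_one]
  change x = (↑u⁻¹ : R) • InjectiveHull.ι R (ResidueField R) (residue R s)
  rw [hz, smul_smul, Units.inv_mul, one_smul]

theorem smul_ι_one_eq_zero {r : R} (hr : r ∈ maximalIdeal R) :
    r • InjectiveHull.ι R (ResidueField R) 1 = 0 := by
  rw [← map_smul, Algebra.smul_def, mul_one, ResidueField.algebraMap_eq,
    (residue_eq_zero_iff r).2 hr, map_zero]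

/-- The injective hull of the residue field of a noetherian local ring is torsion. -/
instance isAdicTorsion_injectiveHull [IsNoetherianRing R] :
    IsAdicTorsion (maximalIdeal R) (InjectiveHull R (ResidueField R)) where
  eq_top := by
    rw [eq_top_iff]
    intro x _
    have hι := InjectiveHull.isInjectiveHull_ι (R := R) (ResidueField R)
    set e := InjectiveHull.ι R (ResidueField R) 1
    have hrange : ∀ y ∈ LinearMap.range (InjectiveHull.ι R (ResidueField R)), y ≠ 0 →
        ∃ c : R, e = c • y := by
      rintro _ ⟨z, rfl⟩ hz
      have hz0 : z ≠ 0 := fun h => hz (by rw [h, map_zero])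
      obtain ⟨c, hc⟩ := residue_surjective z⁻¹
      refine ⟨c, ?_⟩
      rw [← map_smul, Algebra.smul_def, ResidueField.algebraMap_eq, hc, inv_mul_cancel₀ hz0]
    have he : e ≠ 0 := fun h => one_ne_zero (hι.injective (h.trans (map_zero _).symm))
    -- Krull's intersection theorem in Rx: the nonzero e cannot lie in every 𝔪ⁿx.
    have key : ∃ n : ℕ, e ∉ (maximalIdeal R) ^ n • Submodule.span R {x} := by
      by_contra! hcon
      have hx : e ∈ Submodule.span R {x} := Submodule.smul_le_right (hcon 0)
      have hfin : Module.Finite R (Submodule.span R {x}) := inferInstance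
      have := (maximalIdeal R).iInf_pow_smul_eq_bot_of_isLocalRing
        (M := Submodule.span R {x}) (maximalIdeal.isMaximal R).ne_top
      have hmem : (⟨e, hx⟩ : Submodule.span R {x}) ∈
          (⨅ i : ℕ, (maximalIdeal R) ^ i • ⊤ : Submodule R (Submodule.span R {x})) := by
        rw [Submodule.mem_iInf]
        intro n
        exact (Submodule.mem_smul_top_iff _ _ _).2 (hcon n)
      rw [this, Submodule.mem_bot] at hmem
      exact he (congrArg Subtype.val hmem)
    obtain ⟨n, hn⟩ := key
    -- A nonzero element of k inside 𝔪ⁿx would have e as a multiple, so 𝔪ⁿx misses k and vanishes by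
    -- essentiality.
    have h2 : (maximalIdeal R) ^ n • Submodule.span R {x} = ⊥ := by
      refine hι.essential _ ?_
      by_contra h
      obtain ⟨y, ⟨hy, hy'⟩, hy0⟩ := Submodule.exists_mem_ne_zero_of_ne_bot h
      obtain ⟨c, hc⟩ := hrange y hy' hy0
      exact hn (hc ▸ Submodule.smul_mem _ c hy)
    refine ⟨n, fun r hr => ?_⟩
    have : r • x ∈ (maximalIdeal R) ^ n • Submodule.span R {x} :=
      Submodule.smul_mem_smul hr (Submodule.mem_span_singleton_self x)
    rwa [h2, Submodule.mem_bot] at this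

end Hull

/-! ### Generating duals over the completion -/

section DualGeneration

variable {R : Type u} [CommRing R] [IsLocalRing R]

theorem MatlisDual.sum_apply {M : Type v} [AddCommGroup M] [Module R M] {ι : Type*}
    (s : Finset ι) (f : ι → MatlisDual R M) (x : M) : (∑ i ∈ s, f i) x = ∑ i ∈ s, f i x := by
  classical
  induction s using Finset.induction_on with
  | empty => simp [MatlisDual.zero_apply]
  | insert a s ha ih => rw [Finset.sum_insert ha, Finset.sum_insert ha, MatlisDual.add_apply, ih]

theorem MatlisDual.sub_apply {M : Type v} [AddCommGroup M] [Module R M]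
    (f g : MatlisDual R M) (x : M) : (f - g) x = f x - g x :=
  rfl

variable {M : Type u} [AddCommGroup M] [Module R M]

/-- Functionals on `M` vanishing on `(0 :_M I)` are combinations of functionals with coefficients
in the finitely generated ideal `I`. -/
theorem MatlisDual.exists_eq_sum_smul {I : Ideal R} (hI : I.FG) (f : MatlisDual R M)
    (hf : ∀ x : M, (∀ r ∈ I, r • x = 0) → f x = 0) :
    ∃ (s : Finset R) (h : s → MatlisDual R M), (∀ r ∈ s, r ∈ I) ∧
      f = ∑ r : s, (r : R) • h r := by
  classical
  obtain ⟨s, rfl⟩ := hI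
  have hE := (InjectiveHull.isInjectiveHull_ι (R := R) (ResidueField R)).module_injective
  let f' : M →ₗ[R] InjectiveHull R (ResidueField R) := f
  -- The map x ↦ (rx) for r ∈ s has kernel (0 :_M I), so f factors through it; the components of the
  -- factor are the coefficients' functionals.
  obtain ⟨g, hg⟩ := hE.exists_comp_eq
    (LinearMap.pi fun r : s => LinearMap.lsmul R M (r : R)) f' (by
      intro x hx
      refine hf x fun r hr => ?_
      have hs : ∀ t ∈ s, t • x = 0 := fun t ht => congrFun (LinearMap.mem_ker.1 hx) ⟨t, ht⟩
      have : Ideal.span (s : Set R) ≤ LinearMap.ker (LinearMap.toSpanSingleton R M x) :=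
        Ideal.span_le.2 fun t ht => hs t ht
      exact this hr)
  refine ⟨s, fun r => (g ∘ₗ LinearMap.single R (fun _ : s => M) r : M →ₗ[R] _),
    fun r hr => Ideal.subset_span hr, MatlisDual.ext fun x => ?_⟩
  rw [MatlisDual.sum_apply]
  refine (hg x).symm.trans ?_
  rw [← Finset.univ_sum_single ((LinearMap.pi fun r : s => LinearMap.lsmul R M (r : R)) x),
    map_sum]
  rfl

variable [IsNoetherianRing R]

/-- If finitely many functionals generate the restrictions of all functionals to the socle of
the torsion module `M`, then they generate the dual of `M` over the completion. -/
theorem MatlisDual.exists_eq_sum_completion_smul [IsAdicTorsion (maximalIdeal R) M] {ι : Type*}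
    [Fintype ι] (g : ι → MatlisDual R M)
    (hg : ∀ f : MatlisDual R M, ∃ c : ι → R, ∀ x : M, (∀ r ∈ maximalIdeal R, r • x = 0) →
      f x = ∑ i, c i • g i x) (f : MatlisDual R M) :
    ∃ c : ι → AdicCompletion (maximalIdeal R) R, f = ∑ i, c i • g i := by
  classical
  let V : ℕ → MatlisDual R M → Prop := fun n f =>
    ∀ x : M, (∀ r ∈ maximalIdeal R ^ n, r • x = 0) → f x = 0
  -- Write f = ∑ r h_r with r ∈ 𝔪ⁿ. If 𝔪ⁿ⁺¹ kills x, then rx is in the socle, where each h_r is a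
  -- combination of the g_i.
  have step : ∀ n f, V n f → ∃ d : ι → R, (∀ i, d i ∈ maximalIdeal R ^ n) ∧
      V (n + 1) (f - ∑ i, d i • g i) := by
    intro n f hf
    obtain ⟨s, h, hs, rfl⟩ := MatlisDual.exists_eq_sum_smul
      (IsNoetherian.noetherian (maximalIdeal R ^ n)) f hf
    choose c hc using fun r => hg (h r)
    refine ⟨fun i => ∑ r : s, (r : R) * c r i,
      fun i => Ideal.sum_mem _ fun r _ => Ideal.mul_mem_right _ _ (hs r r.2), fun x hx => ?_⟩
    rw [MatlisDual.sub_apply, MatlisDual.sum_apply, MatlisDual.sum_apply, sub_eq_zero]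
    have h1 : ∀ r : s, ((r : R) • h r) x = ∑ i, ((r : R) * c r i) • g i x := by
      intro r
      rw [MatlisDual.smul_apply, hc r ((r : R) • x) fun t ht => by
        rw [smul_smul]
        exact hx _ (by rw [pow_succ']; exact Ideal.mul_mem_mul ht (hs r r.2))]
      refine Finset.sum_congr rfl fun i _ => ?_
      rw [map_smul, smul_smul, mul_comm]
    simp_rw [h1]
    rw [Finset.sum_comm]
    refine Finset.sum_congr rfl fun i _ => ?_
    rw [MatlisDual.smul_apply_self, Finset.sum_smul]
  have hV : ∀ n, ∀ c : {c : ι → R // V n (f - ∑ i, c i • g i)},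
      ∃ c' : {c : ι → R // V (n + 1) (f - ∑ i, c i • g i)},
        ∀ i, c'.1 i - c.1 i ∈ maximalIdeal R ^ n := by
    rintro n ⟨c, hc⟩
    obtain ⟨d, hd, hd'⟩ := step n _ hc
    refine ⟨⟨fun i => c i + d i, ?_⟩, fun i => by simpa using hd i⟩
    have : f - ∑ i, (c i + d i) • g i = f - ∑ i, c i • g i - ∑ i, d i • g i := by
      simp only [add_smul, Finset.sum_add_distrib]
      abel
    rw [this]
    exact hd'
  choose next hnext using hV
  -- The coefficients 0 work at n = 0, because only x = 0 is killed by 𝔪⁰ = R.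
  let c : ∀ n, {c : ι → R // V n (f - ∑ i, c i • g i)} := fun n =>
    Nat.rec ⟨0, fun x hx => by
      have : x = 0 := by simpa using hx 1 (by simp)
      rw [this, map_zero]⟩ next n
  have hc : ∀ n i, (c (n + 1)).1 i - (c n).1 i ∈ maximalIdeal R ^ n := fun n => hnext n (c n)
  let C : ι → AdicCompletion.AdicCauchySequence (maximalIdeal R) R := fun i =>
    AdicCompletion.AdicCauchySequence.mk (maximalIdeal R) R (fun n => (c n).1 i) (fun n => by
      rw [SModEq.comm, SModEq.sub_mem]
      simpa using hc n i)
  refine ⟨fun i => AdicCompletion.mk (maximalIdeal R) R (C i), MatlisDual.ext fun x => ?_⟩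
  obtain ⟨n, hn⟩ := exists_pow_smul_eq_zero (maximalIdeal R) x
  rw [MatlisDual.sum_apply]
  -- On x killed by 𝔪ⁿ, the limit coefficients act as the n-th approximations.
  have h1 := (c n).2 x hn
  rw [MatlisDual.sub_apply, sub_eq_zero, MatlisDual.sum_apply] at h1
  rw [h1]
  refine Finset.sum_congr rfl fun i _ => ?_
  rw [MatlisDual.smul_apply, MatlisDual.smul_apply,
    completion_smul_eq (maximalIdeal R) _ x n hn ((c n).1 i)
      (AdicCompletion.evalₐ_mk (maximalIdeal R) n (C i)).symm]

/-- Matlis: every endomorphism of the injective hull of the residue field is multiplication by an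
element of the completion. -/
theorem exists_endomorphism_eq_completion_smul
    (f : InjectiveHull R (ResidueField R) →ₗ[R] InjectiveHull R (ResidueField R)) :
    ∃ c : AdicCompletion (maximalIdeal R) R, ∀ x, f x = c • x := by
  -- The identity alone suffices as generator, the socle of E being cyclic.
  let g : Unit → MatlisDual R (InjectiveHull R (ResidueField R)) := fun _ => LinearMap.id
  obtain ⟨c, hc⟩ := MatlisDual.exists_eq_sum_completion_smul g (fun f => by
    obtain ⟨c, hc⟩ := exists_eq_smul_ι_one
      (x := f (InjectiveHull.ι R (ResidueField R) 1)) fun r hr => by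
        rw [← map_smul, smul_ι_one_eq_zero hr, map_zero]
    refine ⟨fun _ => c, fun x hx => ?_⟩
    obtain ⟨d, rfl⟩ := exists_eq_smul_ι_one hx
    rw [Finset.univ_unique, Finset.sum_singleton, map_smul, hc, smul_comm]
    rfl) f
  refine ⟨c (), fun x => ?_⟩
  have h := congrArg (fun φ : MatlisDual R (InjectiveHull R (ResidueField R)) => φ x) hc
  rw [Finset.univ_unique, Finset.sum_singleton] at h
  exact h

/-- A functional vanishing on the common kernel of finitely many functionals is a combination of
them over the completion. -/
theorem MatlisDual.exists_eq_sum_completion_smul_of_ker [IsAdicTorsion (maximalIdeal R) M]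
    {ι : Type} [Fintype ι] (g : ι → MatlisDual R M) (f : MatlisDual R M)
    (hf : ∀ x : M, (∀ i, g i x = 0) → f x = 0) :
    ∃ c : ι → AdicCompletion (maximalIdeal R) R, f = ∑ i, c i • g i := by
  classical
  have hE := (InjectiveHull.isInjectiveHull_ι (R := R) (ResidueField R)).module_injective
  let f' : M →ₗ[R] InjectiveHull R (ResidueField R) := f
  let g' : ι → M →ₗ[R] InjectiveHull R (ResidueField R) := g
  -- Factor f through M → E^ι; each component of the factor is an endomorphism of E, hence a scalar
  -- of the completion.
  obtain ⟨h, hh⟩ := hE.exists_comp_eq (LinearMap.pi g') f' fun x hx =>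
    hf x fun i => congrFun (LinearMap.mem_ker.1 hx) i
  choose c hc using fun i => exists_endomorphism_eq_completion_smul
    (h ∘ₗ LinearMap.single R (fun _ : ι => InjectiveHull R (ResidueField R)) i)
  refine ⟨c, MatlisDual.ext fun x => ?_⟩
  rw [MatlisDual.sum_apply]
  refine (hh x).symm.trans ?_
  rw [← Finset.univ_sum_single (LinearMap.pi g' x), map_sum]
  refine Finset.sum_congr rfl fun i _ => ?_
  rw [MatlisDual.smul_apply]
  exact (hc i _).trans (LinearMap.map_completion_smul (g' i) (c i) x).symm

/-- The dual of an artinian module is noetherian over the completion. -/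
instance MatlisDual.isNoetherian [IsArtinian R M] :
    IsNoetherian (AdicCompletion (maximalIdeal R) R) (MatlisDual R M) where
  noetherian N := by
    classical
    -- Choose finitely many functionals in N with minimal common kernel: adjoining any further f ∈ N
    -- cannot shrink it, so f vanishes there and is a combination of them.
    let K : Finset N → Submodule R M := fun s =>
      s.inf fun f => LinearMap.ker (f.1 : M →ₗ[R] InjectiveHull R (ResidueField R))
    obtain ⟨_, ⟨s, rfl⟩, hs⟩ := IsArtinian.set_has_minimal (Set.range K) ⟨K ∅, ∅, rfl⟩
    refine ⟨s.image Subtype.val, le_antisymm (Submodule.span_le.2 ?_) fun f hf => ?_⟩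
    · intro f hf
      obtain ⟨g, -, rfl⟩ := Finset.mem_image.1 hf
      exact g.2
    · have hle : K s ≤ LinearMap.ker (f : M →ₗ[R] InjectiveHull R (ResidueField R)) := by
        have h1 : K (insert ⟨f, hf⟩ s) ≤ K s := Finset.inf_mono (Finset.subset_insert _ _)
        have h2 := eq_of_le_of_not_lt h1 (hs _ ⟨_, rfl⟩)
        rw [← h2]
        exact Finset.inf_le (f := fun f : N =>
          LinearMap.ker (f.1 : M →ₗ[R] InjectiveHull R (ResidueField R)))
          (Finset.mem_insert_self (⟨f, hf⟩ : N) s)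
      obtain ⟨n, ⟨e⟩⟩ : ∃ n, Nonempty (s ≃ Fin n) := ⟨_, ⟨s.equivFin⟩⟩
      obtain ⟨c, hc⟩ := MatlisDual.exists_eq_sum_completion_smul_of_ker
        (fun i : Fin n => (e.symm i).1.1) f fun x hx => hle (by
          refine (Submodule.mem_finsetInf).2 fun g hg => ?_
          have := hx (e ⟨g, hg⟩)
          rw [e.symm_apply_apply] at this
          exact this)
      rw [hc]
      refine Submodule.sum_mem _ fun i _ => Submodule.smul_mem _ _ (Submodule.subset_span ?_)
      exact Finset.mem_image.2 ⟨_, (e.symm i).2, rfl⟩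

end DualGeneration

/-! ### Zero divisors, annihilator primes and support -/

section Commutative

variable {S : Type*} [CommRing S] {N : Type*} [AddCommGroup N] [Module S N]

/-- For generators g_i of N, the map s ↦ (s g_i) embeds S/Ann N in Nⁿ. Passing to this quotient
makes associated primes finite in number without S itself being noetherian. -/
theorem isNoetherianRing_quotient_annihilator [IsNoetherian S N] :
    IsNoetherianRing (S ⧸ Module.annihilator S N) := by
  obtain ⟨n, g, hg⟩ := Module.Finite.exists_fin (R := S) (M := N)
  let F : S →ₗ[S] (Fin n → N) := LinearMap.pi fun i => LinearMap.toSpanSingleton S N (g i)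
  have hF : LinearMap.ker F = Module.annihilator S N := by
    ext s
    rw [LinearMap.mem_ker, Module.mem_annihilator]
    refine ⟨fun h x => ?_, fun h => funext fun i => h (g i)⟩
    have hx : x ∈ Submodule.span S (Set.range g) := hg ▸ trivial
    obtain ⟨c, rfl⟩ := (Submodule.mem_span_range_iff_exists_fun S).1 hx
    rw [Finset.smul_sum]
    refine Finset.sum_eq_zero fun i _ => ?_
    have hi : s • g i = 0 := congrFun h i
    rw [smul_comm, hi, smul_zero]
  rw [← hF]
  exact isNoetherian_of_tower S (isNoetherian_of_injective _ (LinearMap.ker_eq_bot.1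
    (Submodule.ker_liftQ_eq_bot (LinearMap.ker F) F le_rfl le_rfl)))

/-- An ideal consisting of zero divisors on a noetherian module is contained in a prime ideal
that is the annihilator of an element. -/
theorem exists_prime_eq_annihilator_of_not_isSMulRegular [IsNoetherian S N] (J : Ideal S)
    (hJ : ∀ x ∈ J, ¬ IsSMulRegular N x) :
    ∃ (p : PrimeSpectrum S) (f : N), (∀ s, s ∈ p.asIdeal ↔ s • f = 0) ∧ J ≤ p.asIdeal := by
  let a := Module.annihilator S N
  let B := S ⧸ a
  let _ : Module B N := (Module.isTorsionBySet_annihilator S N).module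
  have hsmul : ∀ (s : S) (x : N), (Ideal.Quotient.mk a s : B) • x = s • x :=
    fun s x => Module.IsTorsionBySet.mk_smul _ s x
  have : IsScalarTower S B N := ⟨fun s b x => by
    obtain ⟨t, rfl⟩ := Ideal.Quotient.mk_surjective b
    rw [← Ideal.Quotient.mk_eq_mk, ← Submodule.Quotient.mk_smul, Ideal.Quotient.mk_eq_mk,
      Ideal.Quotient.mk_eq_mk, hsmul, hsmul, smul_eq_mul, mul_smul]⟩
  have : IsNoetherianRing B := isNoetherianRing_quotient_annihilator
  have : Module.Finite B N := Module.Finite.of_restrictScalars_finite S B N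
  -- The zero divisors on N form the union of the finitely many associated primes; prime avoidance
  -- then puts J in one of them.
  have hsub : ((J.map (Ideal.Quotient.mk a) : Ideal B) : Set B) ⊆
      ⋃ p ∈ associatedPrimes B N, (p : Set B) := by
    rw [biUnion_associatedPrimes_eq_compl_regular]
    intro b hb hreg
    obtain ⟨x, hx, rfl⟩ := (Ideal.mem_map_iff_of_surjective _ Ideal.Quotient.mk_surjective).1 hb
    refine hJ x hx fun y z hyz => hreg ?_
    change (Ideal.Quotient.mk a x : B) • y = (Ideal.Quotient.mk a x : B) • z
    rw [hsmul, hsmul]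
    exact hyz
  obtain ⟨p, hp, hle⟩ := (Ideal.subset_union_prime_finite (associatedPrimes.finite B N)
    (f := id) ⊥ ⊥ fun p hp _ _ => hp.isPrime).1 hsub
  obtain ⟨hprime, f, hf⟩ := isAssociatedPrime_iff.1 hp
  refine ⟨⟨p.comap (Ideal.Quotient.mk a), Ideal.comap_isPrime _ _⟩, f, fun s => ?_,
    Ideal.map_le_iff_le_comap.1 hle⟩
  rw [Ideal.mem_comap, hf, Submodule.mem_colon_singleton, hsmul, Submodule.mem_bot]

/-- A finitely generated module has a nonzero map to `S ⧸ p` for every prime `p` of its support. -/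
theorem exists_linearMap_quotient_ne_zero [Module.Finite S N] {p : PrimeSpectrum S}
    (hp : p ∈ Module.support S N) : ∃ (φ : N →ₗ[S] S ⧸ p.asIdeal) (x : N), φ x ≠ 0 := by
  classical
  -- A nonzero κ-linear functional on κ ⊗ N restricts to a nonzero map N → κ, where κ = Frac(S/p).
  let κ := p.asIdeal.ResidueField
  have : Nontrivial (TensorProduct S κ N) :=
    (Module.mem_support_iff_nontrivial_residueField_tensorProduct p).1 hp
  obtain ⟨t, ht⟩ := exists_ne (0 : TensorProduct S κ N)
  obtain ⟨l, hl⟩ : ∃ l : Module.Dual κ (TensorProduct S κ N), l t ≠ 0 := by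
    by_contra! h
    exact ht ((Module.forall_dual_apply_eq_zero_iff κ t).1 h)
  let lam : N →ₗ[S] κ := (l.restrictScalars S) ∘ₗ TensorProduct.mk S κ N 1
  have hlam : ∃ x, lam x ≠ 0 := by
    by_contra! h
    refine hl ?_
    clear hl ht
    induction t using TensorProduct.induction_on with
    | zero => exact map_zero l
    | tmul c x =>
      have h1 : TensorProduct.tmul S c x = c • (TensorProduct.tmul S (1 : κ) x) := by
        rw [TensorProduct.smul_tmul', smul_eq_mul, mul_one]
      have h2 : l (TensorProduct.tmul S (1 : κ) x) = 0 := h x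
      rw [h1, map_smul, h2, smul_zero]
    | add a b ha hb => rw [map_add, ha, hb, add_zero]
  obtain ⟨x, hx⟩ := hlam
  obtain ⟨n, g, hg⟩ := Module.Finite.exists_fin (R := S) (M := N)
  -- A common denominator b for the images of the generators moves the map into S/p.
  obtain ⟨b, hb⟩ := IsLocalization.exist_integer_multiples_of_finite
    (nonZeroDivisors (S ⧸ p.asIdeal)) fun i => lam (g i)
  let α : (S ⧸ p.asIdeal) →ₗ[S] κ :=
    (Algebra.linearMap (S ⧸ p.asIdeal) κ).restrictScalars S
  have hα : Function.Injective α := IsFractionRing.injective (S ⧸ p.asIdeal) κ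
  let mu : N →ₗ[S] κ := (LinearMap.mulLeft S (algebraMap (S ⧸ p.asIdeal) κ b)) ∘ₗ lam
  have hmu : ∀ y, mu y ∈ LinearMap.range α := by
    intro y
    have hy : y ∈ Submodule.span S (Set.range g) := hg ▸ trivial
    induction hy using Submodule.span_induction with
    | mem y hy =>
      obtain ⟨i, rfl⟩ := hy
      obtain ⟨c, hc⟩ := hb i
      exact ⟨c, hc.trans (Algebra.smul_def _ _)⟩
    | zero => rw [map_zero]; exact Submodule.zero_mem _
    | add y z _ _ h h' => rw [map_add]; exact Submodule.add_mem _ h h'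
    | smul c y _ h => rw [map_smul]; exact Submodule.smul_mem _ c h
  refine ⟨(LinearEquiv.ofInjective α hα).symm.toLinearMap ∘ₗ mu.codRestrict _ hmu, x, fun h => ?_⟩
  have h1 : mu.codRestrict _ hmu x = 0 := (LinearEquiv.ofInjective α hα).symm.map_eq_zero_iff.1 h
  have h2 : algebraMap (S ⧸ p.asIdeal) κ b * lam x = 0 := congrArg Subtype.val h1
  rcases mul_eq_zero.1 h2 with h3 | h3
  · exact nonZeroDivisors.ne_zero b.2 (hα (h3.trans (map_zero α).symm))
  · exact hx h3

end Commutative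

/-! ### Biduality and finiteness of the dual -/

section Biduality

variable {R : Type u} [CommRing R] [IsLocalRing R] {M : Type u} [AddCommGroup M] [Module R M]

theorem MatlisDual.eq_zero_of_forall_apply_eq_zero {x : M} (h : ∀ f : MatlisDual R M, f x = 0) :
    x = 0 := by
  by_contra hx
  obtain ⟨f, hf⟩ := exists_dual_apply_ne_zero R hx
  exact hf (h f)

variable [IsNoetherianRing R] [IsAdicTorsion (maximalIdeal R) M]

/-- If the dual of a torsion module `M` is finitely generated over the completion, then every
completion-linear functional on the dual is the evaluation at an element of `M`. -/
theorem MatlisDual.exists_eq_apply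
    [Module.Finite (AdicCompletion (maximalIdeal R) R) (MatlisDual R M)]
    (ψ : MatlisDual R M →ₗ[AdicCompletion (maximalIdeal R) R] InjectiveHull R (ResidueField R)) :
    ∃ b : M, ∀ f : MatlisDual R M, ψ f = f b := by
  classical
  obtain ⟨n, g, hg⟩ := Module.Finite.exists_fin (R := AdicCompletion (maximalIdeal R) R)
    (M := MatlisDual R M)
  let g' : Fin n → M →ₗ[R] InjectiveHull R (ResidueField R) := g
  let F := LinearMap.pi g'
  -- Otherwise some h : Eⁿ/F(M) → E is nonzero on the class of (ψ g_i). Its components are scalars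
  -- c_i; h vanishing on F(M) means ∑ c_i g_i = 0, and applying ψ gives ∑ c_i ψ(g_i) = 0, a
  -- contradiction.
  have hmem : (fun i => ψ (g i)) ∈ LinearMap.range F := by
    by_contra hcon
    have h0 : Submodule.Quotient.mk (p := LinearMap.range F) (fun i => ψ (g i)) ≠ 0 := by
      rwa [Ne, Submodule.Quotient.mk_eq_zero]
    obtain ⟨h, hh⟩ := exists_dual_apply_ne_zero R h0
    choose c hc using fun i => exists_endomorphism_eq_completion_smul
      ((h ∘ₗ Submodule.mkQ _) ∘ₗ
        LinearMap.single R (fun _ : Fin n => InjectiveHull R (ResidueField R)) i)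
    have hsum : ∀ y : Fin n → InjectiveHull R (ResidueField R),
        h (Submodule.Quotient.mk y) = ∑ i, c i • y i := by
      intro y
      have : h (Submodule.Quotient.mk y) = (h ∘ₗ Submodule.mkQ (LinearMap.range F)) y := rfl
      rw [this]
      conv_lhs => rw [← Finset.univ_sum_single y, map_sum]
      exact Finset.sum_congr rfl fun i _ => hc i _
    have hz : ∑ i, c i • g i = 0 := MatlisDual.ext fun x => by
      rw [MatlisDual.sum_apply, MatlisDual.zero_apply]
      have h1 := hsum (F x)
      rw [(Submodule.Quotient.mk_eq_zero _).2 (LinearMap.mem_range_self F x), map_zero] at h1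
      rw [h1]
      refine Finset.sum_congr rfl fun i _ => ?_
      rw [MatlisDual.smul_apply]
      exact LinearMap.map_completion_smul (g' i) (c i) x
    apply hh
    rw [hsum]
    simp_rw [← map_smul]
    rw [← map_sum, hz, map_zero]
  obtain ⟨b, hb⟩ := hmem
  refine ⟨b, fun f => ?_⟩
  have hf : f ∈ Submodule.span (AdicCompletion (maximalIdeal R) R) (Set.range g) := hg ▸ trivial
  induction hf using Submodule.span_induction with
  | mem f hf =>
    obtain ⟨i, rfl⟩ := hf
    exact (congrFun hb i).symm
  | zero => rw [map_zero, MatlisDual.zero_apply]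
  | add f f' _ _ h h' => rw [map_add, h, h', MatlisDual.add_apply]
  | smul c f _ h =>
    rw [map_smul, h, MatlisDual.smul_apply]
    exact (LinearMap.map_completion_smul (f : M →ₗ[R] InjectiveHull R (ResidueField R)) c b).symm

/-- The dual of a torsion module with finitely generated socle is finitely generated over the
completion. -/
theorem MatlisDual.finite_of_socle_fg (V : Submodule R M)
    (hV : ∀ x, x ∈ V ↔ ∀ r ∈ maximalIdeal R, r • x = 0) (hfg : V.FG) :
    Module.Finite (AdicCompletion (maximalIdeal R) R) (MatlisDual R M) := by
  classical
  let E := InjectiveHull R (ResidueField R)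
  have hE := (InjectiveHull.isInjectiveHull_ι (R := R) (ResidueField R)).module_injective
  have : Module.Finite R V := Module.Finite.iff_fg.2 hfg
  obtain ⟨n, v, hv⟩ := Module.Finite.exists_fin (R := R) (M := V)
  let W : Submodule R E := Submodule.span R {InjectiveHull.ι R (ResidueField R) 1}
  -- Functionals on V take values in the socle W of E, so evaluation at generators embeds Hom(V, E)
  -- in the noetherian module Wⁿ.
  let ev : (V →ₗ[R] E) →ₗ[R] (Fin n → W) := LinearMap.pi fun i =>
    LinearMap.codRestrict W (LinearMap.applyₗ (v i)) fun f => by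
      obtain ⟨c, hc⟩ := exists_eq_smul_ι_one (x := f (v i)) fun r hr => by
        rw [← map_smul]
        have : r • v i = 0 := Subtype.ext ((hV _).1 (v i).2 r hr)
        rw [this, map_zero]
      exact Submodule.mem_span_singleton.2 ⟨c, hc.symm⟩
  have hev : Function.Injective ev := by
    intro f f' h
    refine LinearMap.ext_on_range hv fun i => ?_
    exact congrArg Subtype.val (congrFun h i)
  have : Module.Finite R (V →ₗ[R] E) := Module.Finite.of_injective ev hev
  obtain ⟨m, h, hh⟩ := Module.Finite.exists_fin (R := R) (M := V →ₗ[R] E)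
  -- Generators of Hom(V, E) extend to M by injectivity of E.
  choose g hg using fun j => hE.exists_comp_eq V.subtype (h j)
    (by rw [Submodule.ker_subtype]; exact bot_le)
  refine ⟨⟨Finset.univ.image (g : Fin m → MatlisDual R M), eq_top_iff.2 fun f _ => ?_⟩⟩
  obtain ⟨c, rfl⟩ := MatlisDual.exists_eq_sum_completion_smul (g : Fin m → MatlisDual R M)
    (fun f => by
      have hf : (f : M →ₗ[R] E) ∘ₗ V.subtype ∈ Submodule.span R (Set.range h) := hh ▸ trivial
      obtain ⟨c, hc⟩ := (Submodule.mem_span_range_iff_exists_fun R).1 hf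
      refine ⟨c, fun x hx => ?_⟩
      have := LinearMap.congr_fun hc ⟨x, (hV x).2 hx⟩
      rw [LinearMap.sum_apply] at this
      refine this.symm.trans (Finset.sum_congr rfl fun i _ => ?_)
      rw [LinearMap.smul_apply, ← hg]
      rfl) f
  exact Submodule.sum_mem _ fun i _ => Submodule.smul_mem _ _ (Submodule.subset_span
    (Finset.mem_coe.2 (Finset.mem_image_of_mem _ (Finset.mem_univ i))))

/-- The dual of `Γ_𝔪(L)` is finitely generated over the completion if `μ⁰(L)` is finite. -/
theorem MatlisDual.finite_adicTorsion {L : Type u} [AddCommGroup L] [Module R L]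
    (hL : bassNumber R 0 L < ⊤) :
    Module.Finite (AdicCompletion (maximalIdeal R) R)
      (MatlisDual R (adicTorsion (maximalIdeal R) L)) := by
  have e : CategoryTheory.Abelian.Ext (ModuleCat.of R (ResidueField R)) (ModuleCat.of R L) 0
      ≃ₗ[R] (ResidueField R →ₗ[R] L) :=
    CategoryTheory.Abelian.Ext.linearEquiv₀.trans ModuleCat.homLinearEquiv
  have h1 : Module.length R (ResidueField R →ₗ[R] L) ≠ ⊤ := by
    rw [← e.length_eq]
    exact hL.ne
  have := (isFiniteLength_iff_isNoetherian_isArtinian.1 (Module.length_ne_top_iff.1 h1)).1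
  let Γ := adicTorsion (maximalIdeal R) L
  let V : Submodule R Γ := Submodule.torsionBySet R Γ (maximalIdeal R)
  have hV : ∀ x, x ∈ V ↔ ∀ r ∈ maximalIdeal R, r • x = 0 := fun x => by
    simp [V, Submodule.mem_torsionBySet_iff]
  refine MatlisDual.finite_of_socle_fg V hV ?_
  -- Evaluation at 1 carries Hom(k, L) onto a submodule containing the socle of Γ; it is noetherian
  -- as an image of Hom(k, L).
  let T : Submodule R L := LinearMap.range (LinearMap.applyₗ (1 : ResidueField R) :
    (ResidueField R →ₗ[R] L) →ₗ[R] L)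
  have hT : ∀ x : V, ((x : Γ) : L) ∈ T := by
    intro x
    have hx := (hV x.1).1 x.2
    refine ⟨(maximalIdeal R).liftQ (LinearMap.toSpanSingleton R L x.1.1) fun r hr => ?_, ?_⟩
    · exact congrArg Subtype.val (hx r hr)
    · exact one_smul R _
  have hinj : Function.Injective ((Γ.subtype ∘ₗ V.subtype).codRestrict T hT) := fun x y h =>
    Subtype.ext (Subtype.ext (congrArg (fun z : T => (z : L)) h))
  exact Module.Finite.iff_fg.1 (Module.Finite.of_injective _ hinj)

end Biduality

/-! ### Transfer between a torsion module and its dual -/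

section Regular

variable {R : Type u} [CommRing R] [IsLocalRing R]
  {M : Type u} [AddCommGroup M] [Module R M] [IsAdicTorsion (maximalIdeal R) M]

/-- Multiplication on the dual is injective iff multiplication on the module is surjective. -/
theorem MatlisDual.isSMulRegular_iff (x : AdicCompletion (maximalIdeal R) R) :
    IsSMulRegular (MatlisDual R M) x ↔ ∀ a : M, ∃ b : M, x • b = a := by
  constructor
  · intro h
    let μ : M →ₗ[R] M :=
      { toFun := fun b => x • b
        map_add' := smul_add x
        map_smul' := fun r b => (smul_comm r x b).symm }
    by_contra! hcon
    obtain ⟨a, ha⟩ := hcon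
    -- A nonzero functional on M/xM, pulled back to M, is a nonzero element of the dual killed by x.
    have h0 : Submodule.Quotient.mk (p := LinearMap.range μ) a ≠ 0 := by
      rw [Ne, Submodule.Quotient.mk_eq_zero]
      rintro ⟨b, hb⟩
      exact ha b hb
    obtain ⟨g, hg⟩ := exists_dual_apply_ne_zero R h0
    let f : MatlisDual R M := (g ∘ₗ Submodule.mkQ _ : M →ₗ[R] _)
    have hf : f = 0 := h (MatlisDual.ext fun b => by
      change g (Submodule.Quotient.mk (μ b)) = 0
      rw [(Submodule.Quotient.mk_eq_zero _).2 (LinearMap.mem_range_self μ b), map_zero])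
    exact hg (congrArg (fun φ : MatlisDual R M => φ a) hf)
  · intro h f g hfg
    refine MatlisDual.ext fun a => ?_
    obtain ⟨b, rfl⟩ := h a
    exact congrArg (fun φ : MatlisDual R M => φ b) hfg

/-- A prime which is the annihilator of a functional on `M` is attached to `M`. -/
theorem MatlisDual.mem_attachedPrimes {p : PrimeSpectrum (AdicCompletion (maximalIdeal R) R)}
    {f : MatlisDual R M} (hf : ∀ s, s ∈ p.asIdeal ↔ s • f = 0) :
    p ∈ attachedPrimes (AdicCompletion (maximalIdeal R) R) M := by
  -- The largest completion-submodule inside ker f: s annihilates M/K exactly when sf = 0.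
  let K : Submodule (AdicCompletion (maximalIdeal R) R) M :=
    { carrier := {x | ∀ s : AdicCompletion (maximalIdeal R) R, f (s • x) = 0}
      zero_mem' := fun s => by rw [smul_zero, map_zero]
      add_mem' := fun hx hy s => by rw [smul_add, map_add, hx s, hy s, add_zero]
      smul_mem' := fun c x hx s => by rw [smul_smul]; exact hx _ }
  refine ⟨K, ?_⟩
  ext s
  rw [hf, Module.mem_annihilator]
  constructor
  · intro h y
    obtain ⟨x, rfl⟩ := Submodule.Quotient.mk_surjective K y
    rw [← Submodule.Quotient.mk_smul, Submodule.Quotient.mk_eq_zero]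
    intro t
    rw [smul_comm, ← MatlisDual.smul_apply, h, MatlisDual.zero_apply]
  · intro h
    refine MatlisDual.ext fun x => ?_
    have hx := h (Submodule.Quotient.mk x)
    rw [← Submodule.Quotient.mk_smul, Submodule.Quotient.mk_eq_zero] at hx
    rw [MatlisDual.smul_apply, MatlisDual.zero_apply,
      ← one_smul (AdicCompletion (maximalIdeal R) R) (s • x)]
    exact hx 1

/-- Functionals separate points because E is a cogenerator. This identifies the support of a
finitely generated dual with V(Ann M). -/
theorem MatlisDual.annihilator_eq :
    Module.annihilator (AdicCompletion (maximalIdeal R) R) (MatlisDual R M) =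
      Module.annihilator (AdicCompletion (maximalIdeal R) R) M := by
  ext s
  rw [Module.mem_annihilator, Module.mem_annihilator]
  refine ⟨fun h x => MatlisDual.eq_zero_of_forall_apply_eq_zero (R := R) fun f => ?_,
    fun h f => MatlisDual.ext fun x => ?_⟩
  · rw [← MatlisDual.smul_apply, h, MatlisDual.zero_apply]
  · rw [MatlisDual.smul_apply, h, map_zero, MatlisDual.zero_apply]

variable [IsNoetherianRing R] in
/-- Completion-linear maps between duals come from maps of modules. -/
theorem MatlisDual.exists_linearMap_of_dual
    [Module.Finite (AdicCompletion (maximalIdeal R) R) (MatlisDual R M)] {A : Type u}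
    [AddCommGroup A] [Module R A] [IsAdicTorsion (maximalIdeal R) A]
    (φ : MatlisDual R M →ₗ[AdicCompletion (maximalIdeal R) R] MatlisDual R A) :
    ∃ h : A →ₗ[R] M, ∀ (f : MatlisDual R M) (a : A), φ f a = f (h a) := by
  -- For fixed a, the functional f ↦ φ(f)(a) is completion-linear, hence evaluation at a point of M.
  -- That point is unique, which makes the choice linear.
  have key : ∀ a : A, ∃ b : M, ∀ f : MatlisDual R M, φ f a = f b := fun a =>
    MatlisDual.exists_eq_apply
      { toFun := fun f => φ f a
        map_add' := fun f g => by rw [map_add, MatlisDual.add_apply]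
        map_smul' := fun c f => by
          rw [map_smul, MatlisDual.smul_apply]
          exact LinearMap.map_completion_smul
            (φ f : A →ₗ[R] InjectiveHull R (ResidueField R)) c a }
  choose h hh using key
  refine ⟨{ toFun := h, map_add' := fun a b => ?_, map_smul' := fun r a => ?_ },
    fun f a => hh a f⟩
  · rw [← sub_eq_zero]
    refine MatlisDual.eq_zero_of_forall_apply_eq_zero (R := R) fun f => ?_
    rw [map_sub, map_add, ← hh, ← hh, ← hh, map_add, sub_self]
  · rw [← sub_eq_zero]
    refine MatlisDual.eq_zero_of_forall_apply_eq_zero (R := R) fun f => ?_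
    rw [RingHom.id_apply, map_sub, map_smul, ← hh, ← hh, map_smul, sub_self]

end Regular

/-! ### The equivalences -/

theorem mainTheorem11 (R : Type u) [CommRing R] [IsNoetherianRing R] [IsLocalRing R]
    (A : Type u) [AddCommGroup A] [Module R A] [IsArtinian R A]
    (L : Type u) [AddCommGroup L] [Module R L] (hL : bassNumber R 0 L < ⊤) :
    List.TFAE [
      -- (i)
      ∀ f : A →ₗ[R] L, f = 0,
      -- (ii)
      ∀ f : A →ₗ[R] adicTorsion (maximalIdeal R) L, f = 0,
      -- (iii)
      ∀ f : MatlisDual R (adicTorsion (maximalIdeal R) L)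
          →ₗ[AdicCompletion (maximalIdeal R) R] MatlisDual R A, f = 0,
      -- (iv)
      ∃ x ∈ Module.annihilator (AdicCompletion (maximalIdeal R) R)
          (adicTorsion (maximalIdeal R) L),
        ∀ a : A, ∃ b : A, x • b = a,
      -- (v)
      Module.annihilator (AdicCompletion (maximalIdeal R) R) (adicTorsion (maximalIdeal R) L) •
          (⊤ : Submodule (AdicCompletion (maximalIdeal R) R) A) = ⊤,
      -- (vi)
      ∃ x ∈ Module.annihilator (AdicCompletion (maximalIdeal R) R)
          (adicTorsion (maximalIdeal R) L),
        IsSMulRegular (MatlisDual R A) x,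
      -- (vii)
      attachedPrimes (AdicCompletion (maximalIdeal R) R) A ∩
          Module.support (AdicCompletion (maximalIdeal R) R)
            (MatlisDual R (adicTorsion (maximalIdeal R) L)) = ∅] := by
  have hfin := MatlisDual.finite_adicTorsion hL
  have hnot : (¬ ∃ x ∈ Module.annihilator (AdicCompletion (maximalIdeal R) R)
      (adicTorsion (maximalIdeal R) L), IsSMulRegular (MatlisDual R A) x) →
      ∃ (p : PrimeSpectrum (AdicCompletion (maximalIdeal R) R)) (f : MatlisDual R A),
        (∀ s, s ∈ p.asIdeal ↔ s • f = 0) ∧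
        Module.annihilator (AdicCompletion (maximalIdeal R) R)
          (adicTorsion (maximalIdeal R) L) ≤ p.asIdeal := fun h =>
    exists_prime_eq_annihilator_of_not_isSMulRegular _ fun x hx hreg => h ⟨x, hx, hreg⟩
  have hsupp : ∀ p : PrimeSpectrum (AdicCompletion (maximalIdeal R) R),
      p ∈ Module.support (AdicCompletion (maximalIdeal R) R)
        (MatlisDual R (adicTorsion (maximalIdeal R) L)) ↔
      Module.annihilator (AdicCompletion (maximalIdeal R) R)
        (adicTorsion (maximalIdeal R) L) ≤ p.asIdeal := fun p => by
    rw [Module.mem_support_iff_of_finite, MatlisDual.annihilator_eq]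
  tfae_have 1 → 2 := fun h f => LinearMap.ext fun a =>
    Subtype.ext (LinearMap.congr_fun (h ((adicTorsion (maximalIdeal R) L).subtype ∘ₗ f)) a)
  tfae_have 2 → 1 := fun h f => by
    have hf := h (f.codRestrict _ fun a => by
      obtain ⟨n, hn⟩ := exists_pow_smul_eq_zero (maximalIdeal R) a
      exact ⟨n, fun r hr => by rw [← map_smul, hn r hr, map_zero]⟩)
    exact LinearMap.ext fun a => congrArg Subtype.val (LinearMap.congr_fun hf a)
  tfae_have 2 → 3 := fun h φ => by
    obtain ⟨g, hg⟩ := MatlisDual.exists_linearMap_of_dual φ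
    refine LinearMap.ext fun f => MatlisDual.ext fun a => ?_
    rw [hg, h g, LinearMap.zero_apply, map_zero, LinearMap.zero_apply, MatlisDual.zero_apply]
  tfae_have 3 → 6 := fun h => by
    by_contra h6
    obtain ⟨p, f, hf, hp⟩ := hnot h6
    obtain ⟨φ, y, hy⟩ := exists_linearMap_quotient_ne_zero ((hsupp p).2 hp)
    -- The composite Γ^∨ → S/𝔭 → A^∨, with 1 ↦ f in the second map, which is injective because 𝔭 =
    -- Ann(f).
    have h0 := h (p.asIdeal.liftQ (LinearMap.toSpanSingleton _ _ f) (fun s hs => (hf s).1 hs)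
      ∘ₗ φ)
    obtain ⟨s, hs⟩ := Ideal.Quotient.mk_surjective (φ y)
    have h1 := LinearMap.congr_fun h0 y
    rw [LinearMap.comp_apply, ← hs] at h1
    have h2 : s • f = 0 := h1
    exact hy (hs ▸ Ideal.Quotient.eq_zero_iff_mem.2 ((hf s).2 h2))
  tfae_have 4 ↔ 6 := by simp only [MatlisDual.isSMulRegular_iff]
  tfae_have 4 → 5 := fun ⟨x, hx, h⟩ => eq_top_iff.2 fun a _ => by
    obtain ⟨b, rfl⟩ := h a
    exact Submodule.smul_mem_smul hx trivial
  tfae_have 5 → 6 := fun h => by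
    by_contra h6
    obtain ⟨p, f, hf, hp⟩ := hnot h6
    have hf0 : f = 0 := MatlisDual.ext fun a => by
      have ha : a ∈ Module.annihilator (AdicCompletion (maximalIdeal R) R)
          (adicTorsion (maximalIdeal R) L) •
          (⊤ : Submodule (AdicCompletion (maximalIdeal R) R) A) := by rw [h]; trivial
      induction ha using Submodule.smul_induction_on' with
      | smul r hr n _ => rw [← MatlisDual.smul_apply, (hf r).1 (hp hr)]; rfl
      | add x _ y _ hx hy => rw [map_add, hx, hy]; exact add_zero 0
    exact p.2.ne_top ((Ideal.eq_top_iff_one _).2 ((hf 1).2 (by rw [hf0, smul_zero])))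
  tfae_have 6 → 7 := fun ⟨x, hx, hreg⟩ => by
    rw [Set.eq_empty_iff_forall_notMem]
    rintro p ⟨⟨A', hA'⟩, hp⟩
    have hxp : x ∈ p.asIdeal := (hsupp p).1 hp hx
    rw [hA', Module.mem_annihilator] at hxp
    refine p.2.ne_top ((Ideal.eq_top_iff_one _).2 ?_)
    rw [hA', Module.mem_annihilator]
    intro y
    obtain ⟨a, rfl⟩ := Submodule.Quotient.mk_surjective A' y
    -- Surjectivity of x on A, together with x(A/A') = 0, gives A/A' = 0, so p would be the unit
    -- ideal.
    obtain ⟨b, rfl⟩ := (MatlisDual.isSMulRegular_iff x).1 hreg a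
    rw [Submodule.Quotient.mk_smul, hxp, smul_zero]
  tfae_have 7 → 6 := fun h => by
    by_contra h6
    obtain ⟨p, f, hf, hp⟩ := hnot h6
    exact Set.eq_empty_iff_forall_notMem.1 h p
      ⟨MatlisDual.mem_attachedPrimes hf, (hsupp p).2 hp⟩
  tfae_have 4 → 2 := fun ⟨x, hx, h⟩ f => LinearMap.ext fun a => by
    obtain ⟨b, rfl⟩ := h a
    rw [LinearMap.map_completion_smul, Module.mem_annihilator.1 hx]
    rfl
  tfae_finish
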